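/- Let $\mathcal P\subset[0,1]$ be a finite set and $P_P$ a probability mass function on $\mathcal P$; let $P\sim P_P$. The varying binary symmetric channel (VBSC) with state space $\mathcal P$ has input and output alphabet $\{0,1\}$. Its states $p_1,p_2,\dots$ are drawn i.i.d. from $P_P$, independently of the message, and given the states and the inputs the $i$-th use is an independent use of the binary symmetric channel (BSC) with crossover probability $p_i$. For channel state information (CSI) at both encoder and decoder, a code with $M$ messages and block length $n$ consists of an encoder, which maps a message $m$ and the states to $x_1,\dots,x_n\in\{0,1\}$, and a decoder, which maps $(y_1,\dots,y_n)$ and $(p_1,\dots,p_n)$ to a message. The encoder's CSI is either causal ($x_i$ is a function of $m,p_1,\dots,p_i$) or non-causal ($x_i$ is a function of $m,p_1,\dots,p_n$). A rate $R\ge 0$ is achievable if there are codes with $\lceil 2^{nR}\rceil$ messages and block length $n$, for $n\in\mathbb N$, whose error probability, averaged over a uniformly distributed message, the states and the channel noise, tends to $0$ as $n\to\infty$. The capacity $C_{\mathrm{VBSC\text{-}ED}}$ is the supremum of the achievable rates, and $C_{\mathrm{BSC}}(p)$ is the capacity, defined in the same way but without states, of the BSC with crossover probability $p$. Let $H_2(p)=-p\log_2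 p-(1-p)\log_2(1-p)$, with $0\log_2 0=0$. **Theorem.** For causal as well as for non-causal CSI at the encoder (and CSI at the decoder), the suprema defining $C_{\mathrm{VBSC\text{-}ED}}$ and $C_{\mathrm{BSC}}(p)$, $p\in\mathcal P$, are finite, and $$C_{\mathrm{VBSC\text{-}ED}}=\mathbb E\big[C_{\mathrm{BSC}}(P)\big]=1-\mathbb E\big[H_2(P)\big]=\max_{P_{X|P}} I(X;Y|P).$$ The maximum is over all conditional distributions $P_{X|P}$ of an input $X\in\{0,1\}$ given $P$, where $Y$ is the output of the BSC with crossover probability $P$ and input $X$, and $I$ is measured in bits; it is attained by $P_{X|P}(0|p)=P_{X|P}(1|p)=1/2$ for every $p\in\mathcal P$. -/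

import Mathlib

open Filter Topology

noncomputable section

namespace VBSC

/-- The binary entropy function, in bits (with `0 * log 0 = 0`). -/
def H2 (p : ℝ) : ℝ := -p * Real.logb 2 p - (1 - p) * Real.logb 2 (1 - p)

/-- The number `⌈2 ^ (n R)⌉` of messages of a code of block length `n` and rate `R`. -/
def numMessages (R : ℝ) (n : ℕ) : ℕ := ⌈(2 : ℝ) ^ ((n : ℝ) * R)⌉₊

section Memoryless

/-! ### Discrete memoryless channels without state

A channel is given by its transition probabilities `W x y`, the probability of the output `y` given
the input `x`. -/

variable {X Y : Type*} [Fintype Y]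

/-- A block code with `M` messages and block length `n`. -/
structure Code (X Y : Type*) (M n : ℕ) where
  enc : Fin M → Fin n → X
  dec : (Fin n → Y) → Fin M

/-- Average error probability of a code for a uniformly distributed message. -/
def Code.avgError {M n : ℕ} (W : X → Y → ℝ) (c : Code X Y M n) : ℝ :=
  (1 / (M : ℝ)) * ∑ m : Fin M, ∑ y : Fin n → Y,
    if c.dec y = m then 0 else ∏ i, W (c.enc m i) (y i)

/-- The achievable rates (bits per channel use): those for which there are codes of all block
lengths with `⌈2 ^ (n R)⌉` messages whose average error probability tends to `0`. -/
def achievableRates (W : X → Y → ℝ) : Set ℝ :=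
  {R | 0 ≤ R ∧ ∃ c : (n : ℕ) → Code X Y (numMessages R n) n,
    Tendsto (fun n => (c n).avgError W) atTop (𝓝 0)}

/-- The (operational) capacity: the supremum of all achievable rates. -/
def capacity (W : X → Y → ℝ) : ℝ := sSup (achievableRates W)

end Memoryless

section WithState

/-! ### Discrete memoryless channels with i.i.d. state, known to encoder and decoder

The state of each channel use is drawn independently from the pmf `q` on `S`, and `W s x y` is the
probability of the output `y` given the state `s` and the input `x`. -/

variable {S X Y : Type*} [Fintype S] [Fintype X] [Fintype Y]

/-- The two kinds of channel state information at the encoder. -/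
inductive EncoderCSI
  | causal
  | noncausal

/-- A block code with `M` messages and block length `n` for a channel with state, where encoder and
decoder are given the state sequence. -/
structure CSICode (S X Y : Type*) (M n : ℕ) where
  enc : Fin M → (Fin n → S) → Fin n → X
  dec : (Fin n → Y) → (Fin n → S) → Fin M

/-- In the causal case the `i`-th codeword symbol depends only on the message and on the states up
to time `i`; in the non-causal case it may depend on the whole state sequence. -/
def CSICode.Admissible {M n : ℕ} (csi : EncoderCSI) (c : CSICode S X Y M n) : Prop :=
  match csi with
  | .causal => ∀ (m : Fin M) (s s' : Fin n → S) (i : Fin n),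
      (∀ j ≤ i, s j = s' j) → c.enc m s i = c.enc m s' i
  | .noncausal => True

/-- Average error probability of a code for a uniformly distributed message that is independent of
the i.i.d. state sequence. -/
def CSICode.avgError {M n : ℕ} (q : S → ℝ) (W : S → X → Y → ℝ) (c : CSICode S X Y M n) : ℝ :=
  (1 / (M : ℝ)) * ∑ m : Fin M, ∑ s : Fin n → S, (∏ i, q (s i)) *
    ∑ y : Fin n → Y, if c.dec y s = m then 0 else ∏ i, W (s i) (c.enc m s i) (y i)

/-- The achievable rates (bits per channel use) with state information at encoder and decoder. -/
def achievableRatesED (csi : EncoderCSI) (q : S → ℝ) (W : S → X → Y → ℝ) : Set ℝ :=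
  {R | 0 ≤ R ∧ ∃ c : (n : ℕ) → CSICode S X Y (numMessages R n) n,
    (∀ n, (c n).Admissible csi) ∧ Tendsto (fun n => (c n).avgError q W) atTop (𝓝 0)}

/-- The (operational) capacity with state information at encoder and decoder. -/
def capacityED (csi : EncoderCSI) (q : S → ℝ) (W : S → X → Y → ℝ) : ℝ :=
  sSup (achievableRatesED csi q W)

/-- The conditional mutual information `I(X;Y|P)`, in bits, of a triple `(P, X, Y)` with joint pmf
`μ s x y`. -/
def condMutualInfo (μ : S → X → Y → ℝ) : ℝ :=
  ∑ s, ∑ x, ∑ y, μ s x y *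
    Real.logb 2 ((μ s x y * ∑ x', ∑ y', μ s x' y') / ((∑ y', μ s x y') * ∑ x', μ s x' y))

/-- The joint pmf of state, input and output for the state pmf `q`, the conditional input pmf
`κ s x` (of the input `x` given the state `s`) and the channel `W`. -/
def jointPmf (q : S → ℝ) (κ : S → X → ℝ) (W : S → X → Y → ℝ) : S → X → Y → ℝ :=
  fun s x y => q s * κ s x * W s x y

end WithState

/-- The binary symmetric channel with crossover probability `p`. -/
def bsc (p : ℝ) (x y : Fin 2) : ℝ := if y = x then 1 - p else p

/-- The varying binary symmetric channel with finite state space `S ⊆ [0,1]`: in state `p ∈ S` it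
acts as the binary symmetric channel with crossover probability `p`. -/
def vbsc (S : Finset unitInterval) (p : S) : Fin 2 → Fin 2 → ℝ := bsc (p : unitInterval)

/-- `C_BSC(p)`, the capacity of the binary symmetric channel with crossover probability `p`. -/
def CBSC (p : ℝ) : ℝ := capacity (bsc p)

end VBSC

end

open Filter Topology

/-! Given the states `s`, the channel adds to the codeword, in the group of binary words of length
n, a noise word with law `noiseProb p s`. The decoder knows `s`, so only the spread of this law
matters. Averaged over the states, the self-information of the noise is a sum of n i.i.d. terms of
mean E[H2(P)], so Chebyshev's inequality concentrates it around n E[H2(P)]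
(`exists_noise_concentration`).

Achievability (`exists_code_error_le`): a state-independent codebook, decoded by searching for the
only codeword that makes the noise likely enough, fails with probability at most P(atypical noise) +
(M - 1) 2^(n(E[H2(P)] + ε)) / 2^n. Converse (`success_le`): even if the codewords depend on all the
states, correct decoding has probability at most P(atypical noise) + 2^n 2^(-n(E[H2(P)] - ε)) / M,
which tends to 0 above capacity. Both kinds of CSI thus give 1 - E[H2(P)]. A single BSC is the case
of a one-point state space. Finally, I(X;Y|P) is the mean of H2 of the output law minus H2(P), and
H2 is at most 1, with equality at 1/2. -/

namespace VBSC

/-! ### Sums of i.i.d. variables and Chebyshev's inequality. -/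

section ProductPmf

variable {Ω : Type*} [Fintype Ω]

theorem sum_fin_succ_prod_mul (P : Ω → ℝ) (n : ℕ) (F : (Fin (n + 1) → Ω) → ℝ) :
    ∑ ω : Fin (n + 1) → Ω, (∏ i, P (ω i)) * F ω =
      ∑ a, ∑ ω : Fin n → Ω, P a * ((∏ i, P (ω i)) * F (Fin.cons a ω)) := by
  rw [← Fintype.sum_prod_type', ← (Fin.consEquiv (fun _ : Fin (n + 1) => Ω)).sum_comp]
  refine Finset.sum_congr rfl fun x _ => ?_
  simp [Fin.consEquiv, Fin.prod_univ_succ, mul_assoc]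

theorem sum_pi_prod_eq_one {P : Ω → ℝ} (hP : ∑ a, P a = 1) (n : ℕ) :
    ∑ ω : Fin n → Ω, ∏ i, P (ω i) = 1 := by
  classical
  rw [← Fintype.piFinset_univ, Finset.sum_prod_piFinset]
  simp [hP]

theorem sum_pi_prod_mul_sum {P g : Ω → ℝ} (hP : ∑ a, P a = 1) (hg : ∑ a, P a * g a = 0) (n : ℕ) :
    ∑ ω : Fin n → Ω, (∏ i, P (ω i)) * ∑ i, g (ω i) = 0 := by
  induction n with
  | zero => simp
  | succ n ih =>
    rw [sum_fin_succ_prod_mul]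
    simp only [Fin.sum_univ_succ, Fin.cons_zero, Fin.cons_succ, mul_add, Finset.sum_add_distrib]
    simp only [← Finset.mul_sum, ih, ← Finset.sum_mul, sum_pi_prod_eq_one hP]
    simp [hg]

theorem sum_pi_prod_mul_sum_sq {P g : Ω → ℝ} (hP : ∑ a, P a = 1) (hg : ∑ a, P a * g a = 0)
    (n : ℕ) :
    ∑ ω : Fin n → Ω, (∏ i, P (ω i)) * (∑ i, g (ω i)) ^ 2 = n * ∑ a, P a * g a ^ 2 := by
  induction n with
  | zero => simp
  | succ n ih =>
    rw [sum_fin_succ_prod_mul]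
    have key : ∀ a, ∑ ω : Fin n → Ω, P a * ((∏ i, P (ω i)) *
        (∑ i, g ((Fin.cons a ω : Fin (n + 1) → Ω) i)) ^ 2) =
        P a * g a ^ 2 + P a * (n * ∑ a, P a * g a ^ 2) := by
      intro a
      rw [← Finset.mul_sum, ← ih, ← mul_add]
      congr 1
      have h1 := sum_pi_prod_eq_one hP n
      have h2 := sum_pi_prod_mul_sum hP hg n
      calc _ = ∑ ω : Fin n → Ω, (g a ^ 2 * (∏ i, P (ω i)) +
            2 * g a * ((∏ i, P (ω i)) * ∑ i, g (ω i)) +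
            (∏ i, P (ω i)) * (∑ i, g (ω i)) ^ 2) := by
            refine Finset.sum_congr rfl fun ω _ => ?_
            simp only [Fin.sum_univ_succ, Fin.cons_zero, Fin.cons_succ]
            ring
        _ = _ := by
            rw [Finset.sum_add_distrib, Finset.sum_add_distrib, ← Finset.mul_sum, ← Finset.mul_sum,
              h1, h2]
            ring
    simp only [key, Finset.sum_add_distrib, ← Finset.sum_mul, hP]
    push_cast
    ring

/-- Chebyshev's inequality: the variance of the sum is n times that of one term. -/
theorem sum_pi_deviation_le {P g : Ω → ℝ} (hP0 : ∀ a, 0 ≤ P a) (hP : ∑ a, P a = 1)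
    (hg : ∑ a, P a * g a = 0) {n : ℕ} (hn : 0 < n) {ε : ℝ} (hε : 0 < ε) :
    ∑ ω : Fin n → Ω, (if n * ε ≤ |∑ i, g (ω i)| then ∏ i, P (ω i) else 0) ≤
      (∑ a, P a * g a ^ 2) / (n * ε ^ 2) := by
  have hn' : (0 : ℝ) < n := by exact_mod_cast hn
  have hne : 0 < n * ε := mul_pos hn' hε
  calc _ ≤ ∑ ω : Fin n → Ω, ((∏ i, P (ω i)) * (∑ i, g (ω i)) ^ 2) / (n * ε) ^ 2 := by
        refine Finset.sum_le_sum fun ω _ => ?_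
        have h0 : 0 ≤ ∏ i, P (ω i) := Finset.prod_nonneg fun i _ => hP0 _
        split_ifs with h
        · rw [le_div_iff₀ (by positivity)]
          refine mul_le_mul_of_nonneg_left ?_ h0
          rw [← sq_abs (∑ i, g (ω i))]
          exact pow_le_pow_left₀ hne.le h 2
        · positivity
    _ = _ := by
        rw [← Finset.sum_div, sum_pi_prod_mul_sum_sq hP hg]
        field_simp

end ProductPmf

/-! ### One-shot coding bounds for additive noise on a finite group. -/

section AdditiveNoise

variable {A G : Type*} [Fintype A] [Fintype G] [AddCommGroup G]

/-- A codebook, chosen one codeword after the other, whose differences are no worse than those of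
independent uniform codewords. -/
theorem exists_codebook_sum_sub_le (K : G → ℝ) (M : ℕ) :
    ∃ c : Fin M → G, ∑ m, ∑ m', (if m' = m then 0 else K (c m - c m')) ≤
      M * (M - 1) * ((∑ g, K g) / Fintype.card G) := by
  induction M with
  | zero => exact ⟨fun _ => 0, by simp⟩
  | succ M ih =>
    obtain ⟨c, hc⟩ := ih
    have hG : (0 : ℝ) < Fintype.card G := by exact_mod_cast Fintype.card_pos
    -- Some new codeword does at least as well as the average over a uniform one. Both orders of
    -- each pair are counted, as `K` need not be even.
    obtain ⟨x, -, hx⟩ : ∃ x ∈ (Finset.univ : Finset G),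
        ∑ j, (K (x - c j) + K (c j - x)) ≤ 2 * M * ((∑ g, K g) / Fintype.card G) := by
      refine Finset.exists_le_of_sum_le Finset.univ_nonempty (le_of_eq ?_)
      rw [Finset.sum_comm]
      have h1 : ∀ j, ∑ x, K (x - c j) = ∑ g, K g := fun j => (Equiv.subRight (c j)).sum_comp K
      have h2 : ∀ j, ∑ x, K (c j - x) = ∑ g, K g := fun j => (Equiv.subLeft (c j)).sum_comp K
      simp only [Finset.sum_add_distrib, h1, h2]
      simp only [Finset.sum_const, Finset.card_univ, Fintype.card_fin, nsmul_eq_mul]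
      field_simp
      ring
    refine ⟨Fin.cons x c, ?_⟩
    simp only [Fin.sum_univ_succ, Fin.cons_zero, Fin.cons_succ, Fin.succ_inj, Fin.succ_ne_zero,
      (Fin.succ_ne_zero _).symm, if_true, if_false, Finset.sum_add_distrib, zero_add]
    rw [Finset.sum_add_distrib] at hx
    push_cast
    linarith

/-- An error requires that the noise leaves `T s` or that its shift by `c m - c m'` lies in `T s`
for some other message `m'`. A union bound turns the second event into a sum over differences of
codewords, to which the codebook lemma applies. -/
theorem exists_code_error_le {Q : A → ℝ} (hQ0 : ∀ s, 0 ≤ Q s) (hQ : ∑ s, Q s = 1)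
    {N : A → G → ℝ} (hN0 : ∀ s z, 0 ≤ N s z) (hN : ∀ s, ∑ z, N s z = 1)
    (T : A → Set G) [∀ s, DecidablePred (· ∈ T s)] {B : ℝ}
    (hT : ∀ s, ∑ z, (if z ∈ T s then (1 : ℝ) else 0) ≤ B) {M : ℕ} (hM : 0 < M) :
    ∃ (c : Fin M → G) (dec : G → A → Fin M),
      (1 / (M : ℝ)) * ∑ m, ∑ s, Q s * ∑ y, (if dec y s = m then 0 else N s (y - c m)) ≤
        (∑ s, Q s * ∑ z, if z ∈ T s then 0 else N s z) + (M - 1) * (B / Fintype.card G) := by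
  classical
  have hM' : (0 : ℝ) < M := by exact_mod_cast hM
  have hM1 : (1 : ℝ) ≤ M := by exact_mod_cast hM
  have hG : (0 : ℝ) < Fintype.card G := by exact_mod_cast Fintype.card_pos
  -- `K d` is the probability that a competing codeword at difference `d` also passes the test.
  set K : G → ℝ := fun d => ∑ s, Q s * ∑ z, if d + z ∈ T s then N s z else 0 with hK
  have hKsum : ∑ d, K d ≤ B := by
    calc ∑ d, K d = ∑ s, Q s * ∑ z, N s z * ∑ d, (if d + z ∈ T s then (1 : ℝ) else 0) := by
          simp only [hK]
          rw [Finset.sum_comm]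
          refine Finset.sum_congr rfl fun s _ => ?_
          rw [← Finset.mul_sum, Finset.sum_comm]
          congr 1
          refine Finset.sum_congr rfl fun z _ => ?_
          simp only [Finset.mul_sum, mul_ite, mul_one, mul_zero]
      _ ≤ ∑ s, Q s * ∑ z, N s z * B := by
          gcongr with s _ z _
          · exact hQ0 s
          · exact hN0 s z
          · exact (Equiv.sum_comp (Equiv.addRight z)
              (fun g => if g ∈ T s then (1 : ℝ) else 0)).le.trans (hT s)
      _ = B := by simp only [← Finset.sum_mul, hN, one_mul, hQ]
  obtain ⟨c, hc⟩ := exists_codebook_sum_sub_le K M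
  let good : G → A → Fin M → Prop := fun y s m =>
    y - c m ∈ T s ∧ ∀ m', m' ≠ m → y - c m' ∉ T s
  -- The fallback message is arbitrary: the bound only uses that a good message is decoded
  -- correctly.
  let dec : G → A → Fin M := fun y s =>
    if h : ∃ m, good y s m then h.choose else ⟨0, hM⟩
  have hdec : ∀ y s m, good y s m → dec y s = m := by
    intro y s m hm
    have h : ∃ m, good y s m := ⟨m, hm⟩
    simp only [dec, dif_pos h]
    by_contra hne
    exact hm.2 _ hne h.choose_spec.1
  refine ⟨c, dec, ?_⟩
  have hterm : ∀ m s, ∑ y, (if dec y s = m then 0 else N s (y - c m)) ≤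
      (∑ z, if z ∈ T s then 0 else N s z) +
        ∑ m', if m' = m then 0 else ∑ z, if c m - c m' + z ∈ T s then N s z else 0 := by
    intro m s
    rw [← Equiv.sum_comp (Equiv.addRight (c m))]
    have hsw : (∑ m', if m' = m then 0 else ∑ z, if c m - c m' + z ∈ T s then N s z else 0) =
        ∑ z, ∑ m', if m' = m then 0 else if c m - c m' + z ∈ T s then N s z else 0 := by
      rw [Finset.sum_comm]
      refine Finset.sum_congr rfl fun m' _ => ?_
      split_ifs <;> simp
    rw [hsw, ← Finset.sum_add_distrib]
    refine Finset.sum_le_sum fun z _ => ?_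
    have hnn : ∀ m' ∈ (Finset.univ : Finset (Fin M)),
        0 ≤ (if m' = m then 0 else if c m - c m' + z ∈ T s then N s z else 0) := by
      intro m' _
      split_ifs <;> first | exact le_rfl | exact hN0 s z
    have hs := Finset.sum_nonneg hnn
    simp only [Equiv.coe_addRight, add_sub_cancel_right]
    by_cases hd : dec (z + c m) s = m
    · rw [if_pos hd]
      have : 0 ≤ (if z ∈ T s then 0 else N s z) := by
        split_ifs <;> first | exact le_rfl | exact hN0 s z
      linarith
    · rw [if_neg hd]
      by_cases hz : z ∈ T s
      · have hng : ¬ good (z + c m) s m := fun h => hd (hdec _ _ _ h)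
        simp only [good, add_sub_cancel_right, hz, true_and, not_forall, not_not] at hng
        obtain ⟨m', hne, hm'⟩ := hng
        have := Finset.single_le_sum hnn (Finset.mem_univ m')
        have he : c m - c m' + z = z + c m - c m' := by abel
        rw [if_neg hne, he, if_pos hm'] at this
        rw [if_pos hz]
        linarith
      · rw [if_neg hz]
        linarith
  set δ := ∑ s, Q s * ∑ z, if z ∈ T s then 0 else N s z with hδ
  have hm : ∀ m, ∑ s, Q s * ∑ y, (if dec y s = m then 0 else N s (y - c m)) ≤
      δ + ∑ m', if m' = m then 0 else K (c m - c m') := by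
    intro m
    calc _ ≤ ∑ s, Q s * ((∑ z, if z ∈ T s then 0 else N s z) +
        ∑ m', if m' = m then 0 else ∑ z, if c m - c m' + z ∈ T s then N s z else 0) :=
          Finset.sum_le_sum fun s _ => mul_le_mul_of_nonneg_left (hterm m s) (hQ0 s)
      _ = _ := by
          simp only [mul_add, Finset.sum_add_distrib, hδ, hK]
          congr 1
          simp only [Finset.mul_sum (s := (Finset.univ : Finset (Fin M)))]
          rw [Finset.sum_comm]
          refine Finset.sum_congr rfl fun m' _ => ?_
          split_ifs <;> simp
  calc _ ≤ (1 / (M : ℝ)) * ∑ m, (δ + ∑ m', if m' = m then 0 else K (c m - c m')) := by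
        gcongr with m _
        exact hm m
    _ ≤ (1 / (M : ℝ)) * (M * δ + M * (M - 1) * (B / Fintype.card G)) := by
        rw [Finset.sum_add_distrib]
        gcongr
        · simp
        · refine hc.trans ?_
          have : 0 ≤ (M : ℝ) * (M - 1) := mul_nonneg hM'.le (by linarith)
          gcongr
    _ = _ := by field_simp

/-- Noise values of probability above `b` are charged to the first term. Every other output
contributes at most `b`, and for a given state each output is decoded to one message only, so
summing over the messages gives at most `b` times the size of `G`. -/
theorem success_le {Q : A → ℝ} (hQ0 : ∀ s, 0 ≤ Q s) (hQ : ∑ s, Q s = 1)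
    {N : A → G → ℝ} {b : ℝ} (hb : 0 ≤ b) {M : ℕ} (hM : 0 < M) (hN0 : ∀ s z, 0 ≤ N s z)
    (c : Fin M → A → G) (dec : G → A → Fin M) :
    (1 / (M : ℝ)) * ∑ m, ∑ s, Q s * ∑ y, (if dec y s = m then N s (y - c m s) else 0) ≤
      (∑ s, Q s * ∑ z, if N s z ≤ b then 0 else N s z) + Fintype.card G * b / M := by
  have hM' : (0 : ℝ) < M := by exact_mod_cast hM
  set δ := ∑ s, Q s * ∑ z, if N s z ≤ b then 0 else N s z with hδ
  have hterm : ∀ m s, ∑ y, (if dec y s = m then N s (y - c m s) else 0) ≤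
      (∑ z, if N s z ≤ b then 0 else N s z) + ∑ y, if dec y s = m then b else 0 := by
    intro m s
    rw [← (Equiv.subRight (c m s)).sum_comp (fun z => if N s z ≤ b then 0 else N s z),
      ← Finset.sum_add_distrib]
    refine Finset.sum_le_sum fun y _ => ?_
    have := hN0 s (y - c m s)
    simp only [Equiv.subRight_apply]
    split_ifs <;> linarith
  calc _ ≤ (1 / (M : ℝ)) * ∑ m, ∑ s, Q s * ((∑ z, if N s z ≤ b then 0 else N s z) +
          ∑ y, if dec y s = m then b else 0) := by
        gcongr with m _ s _
        · exact hQ0 s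
        · exact hterm m s
    _ = (1 / (M : ℝ)) * (M * δ + ∑ s, Q s * ∑ y, ∑ m, if dec y s = m then b else 0) := by
        congr 1
        simp only [mul_add, Finset.sum_add_distrib, ← hδ, Finset.sum_const, Finset.card_univ,
          Fintype.card_fin, nsmul_eq_mul]
        congr 1
        rw [Finset.sum_comm]
        refine Finset.sum_congr rfl fun s _ => ?_
        rw [← Finset.mul_sum, Finset.sum_comm]
    _ = _ := by
        simp only [Finset.sum_ite_eq, Finset.mem_univ, if_true, Finset.sum_const, Finset.card_univ,
          nsmul_eq_mul, ← Finset.sum_mul, hQ, one_mul]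
        field_simp

end AdditiveNoise

/-! ### Binary noise and the concentration of its self-information. -/

section BinarySymmetric

theorem bsc_eq_sub (p : ℝ) (x y : Fin 2) : bsc p x y = bsc p 0 (y - x) := by
  fin_cases x <;> fin_cases y <;> simp [bsc]

theorem bsc_nonneg {p : ℝ} (hp : p ∈ Set.Icc (0 : ℝ) 1) (x y : Fin 2) : 0 ≤ bsc p x y := by
  unfold bsc
  split_ifs
  · linarith [hp.2]
  · exact hp.1

theorem sum_bsc (p : ℝ) (x : Fin 2) : ∑ y, bsc p x y = 1 := by
  fin_cases x <;> simp [bsc, Fin.sum_univ_two]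

theorem sum_bsc_mul_logb (p : ℝ) (x : Fin 2) :
    ∑ y, bsc p x y * Real.logb 2 (bsc p x y) = -H2 p := by
  fin_cases x <;> simp [bsc, H2, Fin.sum_univ_two]
  ring

theorem H2_eq_binEntropy_div (p : ℝ) : H2 p = Real.binEntropy p / Real.log 2 := by
  simp only [H2, Real.binEntropy, Real.logb, Real.log_inv]
  ring

theorem H2_le_one (p : ℝ) : H2 p ≤ 1 := by
  rw [H2_eq_binEntropy_div, div_le_one (Real.log_pos one_lt_two)]
  exact Real.binEntropy_le_log_two

variable {S : Type*} {n : ℕ}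

/-- The probability of the noise sequence `z` given the state sequence `s`. -/
noncomputable def noiseProb (p : S → ℝ) (s : Fin n → S) (z : Fin n → Fin 2) : ℝ :=
  ∏ i, bsc (p (s i)) 0 (z i)

theorem prod_bsc_eq_noiseProb (p : S → ℝ) (s : Fin n → S) (x y : Fin n → Fin 2) :
    ∏ i, bsc (p (s i)) (x i) (y i) = noiseProb p s (y - x) :=
  Finset.prod_congr rfl fun _ _ => bsc_eq_sub _ _ _

theorem noiseProb_nonneg {p : S → ℝ} (hp : ∀ s, p s ∈ Set.Icc (0 : ℝ) 1) (s : Fin n → S)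
    (z : Fin n → Fin 2) : 0 ≤ noiseProb p s z :=
  Finset.prod_nonneg fun _ _ => bsc_nonneg (hp _) _ _

theorem sum_noiseProb (p : S → ℝ) (s : Fin n → S) : ∑ z, noiseProb p s z = 1 := by
  simp only [noiseProb]
  rw [← Fintype.piFinset_univ, ← Finset.prod_univ_sum]
  simp only [sum_bsc, Finset.prod_const_one]

theorem logb_noiseProb {p : S → ℝ} {s : Fin n → S} {z : Fin n → Fin 2}
    (h : noiseProb p s z ≠ 0) :
    Real.logb 2 (noiseProb p s z) = ∑ i, Real.logb 2 (bsc (p (s i)) 0 (z i)) := by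
  simp only [Real.logb, noiseProb, ← Finset.sum_div]
  rw [Real.log_prod]
  exact fun i hi => Finset.prod_ne_zero_iff.1 h i hi

variable [Fintype S]

/-- The mean entropy `𝔼[H₂(P)]`. -/
noncomputable def meanH2 (q p : S → ℝ) : ℝ := ∑ s, q s * H2 (p s)

theorem one_sub_meanH2 {q : S → ℝ} (hq : q ∈ stdSimplex ℝ S) (p : S → ℝ) :
    1 - meanH2 q p = ∑ s, q s * (1 - H2 (p s)) := by
  simp only [meanH2, mul_sub, mul_one, Finset.sum_sub_distrib, hq.2]

/-- Chebyshev's inequality for the i.i.d. pairs of state and noise bit; `K` is the variance of the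
self-information of one noise bit. Letters of probability zero carry no weight, so the value of
their logarithm is harmless. -/
theorem exists_noise_deviation_le {q : S → ℝ} (hq : q ∈ stdSimplex ℝ S) {p : S → ℝ}
    (hp : ∀ s, p s ∈ Set.Icc (0 : ℝ) 1) :
    ∃ K : ℝ, ∀ ε > 0, ∀ n : ℕ, 0 < n →
      ∑ s : Fin n → S, (∏ i, q (s i)) * ∑ z,
        (if n * ε ≤ |(∑ i, -Real.logb 2 (bsc (p (s i)) 0 (z i))) - n * meanH2 q p|
          then noiseProb p s z else 0) ≤ K / ε ^ 2 / n := by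
  let P : S × Fin 2 → ℝ := fun a => q a.1 * bsc (p a.1) 0 a.2
  let g : S × Fin 2 → ℝ := fun a => -Real.logb 2 (bsc (p a.1) 0 a.2) - meanH2 q p
  have hP0 : ∀ a, 0 ≤ P a := fun a => mul_nonneg (hq.1 _) (bsc_nonneg (hp _) _ _)
  have hP : ∑ a, P a = 1 := by
    simp only [P]
    rw [Fintype.sum_prod_type]
    simp only [← Finset.mul_sum, sum_bsc, mul_one, hq.2]
  have hg : ∑ a, P a * g a = 0 := by
    have h1 : ∀ a, P a * g a = q a.1 * -(bsc (p a.1) 0 a.2 * Real.logb 2 (bsc (p a.1) 0 a.2)) -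
        P a * meanH2 q p := fun a => by simp only [P, g]; ring
    simp only [h1, Finset.sum_sub_distrib, ← Finset.sum_mul, hP]
    rw [Fintype.sum_prod_type]
    simp only [← Finset.mul_sum, Finset.sum_neg_distrib, sum_bsc_mul_logb, neg_neg, one_mul]
    exact sub_self _
  refine ⟨∑ a, P a * g a ^ 2, fun ε hε n hn => ?_⟩
  have h := sum_pi_deviation_le hP0 hP hg hn hε
  -- A sequence of pairs is read as a pair of sequences, states and noise.
  rw [← (Equiv.arrowProdEquivProdArrow (Fin n) (fun _ => S) (fun _ => Fin 2)).symm.sum_comp,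
    Fintype.sum_prod_type] at h
  rw [div_div, mul_comm (ε ^ 2)]
  refine le_trans (le_of_eq ?_) h
  refine Finset.sum_congr rfl fun s _ => ?_
  rw [Finset.mul_sum]
  refine Finset.sum_congr rfl fun z _ => ?_
  simp [P, g, Finset.prod_mul_distrib, noiseProb, Finset.sum_sub_distrib]

/-- The two tails separately: noise that is too unlikely spoils achievability, noise that is too
likely spoils the converse. -/
theorem exists_noise_concentration {q : S → ℝ} (hq : q ∈ stdSimplex ℝ S) {p : S → ℝ}
    (hp : ∀ s, p s ∈ Set.Icc (0 : ℝ) 1) :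
    ∃ K : ℝ, ∀ ε > 0, ∀ n : ℕ, 0 < n →
      ∑ s : Fin n → S, (∏ i, q (s i)) * ∑ z,
        (if (2 : ℝ) ^ (-(n * (meanH2 q p + ε))) ≤ noiseProb p s z then 0 else noiseProb p s z) ≤
          K / ε ^ 2 / n ∧
      ∑ s : Fin n → S, (∏ i, q (s i)) * ∑ z,
        (if noiseProb p s z ≤ (2 : ℝ) ^ (-(n * (meanH2 q p - ε))) then 0 else noiseProb p s z) ≤
          K / ε ^ 2 / n := by
  obtain ⟨K, hK⟩ := exists_noise_deviation_le hq hp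
  refine ⟨K, fun ε hε n hn => ⟨le_trans ?_ (hK ε hε n hn), le_trans ?_ (hK ε hε n hn)⟩⟩ <;>
  · refine Finset.sum_le_sum fun s _ => mul_le_mul_of_nonneg_left ?_
      (Finset.prod_nonneg fun i _ => hq.1 _)
    refine Finset.sum_le_sum fun z _ => ?_
    rcases (noiseProb_nonneg hp s z).eq_or_lt with h0 | h0
    · rw [← h0]; simp
    · have hl := logb_noiseProb h0.ne'
      split_ifs with h1 h2 h2
      · exact h0.le
      · exact le_rfl
      · exact le_rfl
      · exfalso
        apply h2
        rw [not_le] at h1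
        rw [Finset.sum_neg_distrib, ← hl, le_abs]
        first
        | have := (Real.logb_lt_iff_lt_rpow one_lt_two h0).2 h1
          left; linarith
        | have := (Real.lt_logb_iff_rpow_lt one_lt_two h0).2 h1
          right; linarith

end BinarySymmetric

/-! ### Achievability, converse and the operational capacities. -/

section Coding

variable {S : Type*} [Fintype S]

theorem numMessages_pos (R : ℝ) (n : ℕ) : 0 < numMessages R n :=
  Nat.ceil_pos.2 (Real.rpow_pos_of_pos two_pos _)

theorem tendsto_error_bound (K : ℝ) {ε : ℝ} (hε : 0 < ε) :
    Tendsto (fun n : ℕ => K / ε ^ 2 / n + (2 : ℝ) ^ (-(n * ε))) atTop (𝓝 0) := by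
  have h1 : Tendsto (fun n : ℕ => K / ε ^ 2 / (n : ℝ)) atTop (𝓝 0) :=
    tendsto_const_div_atTop_nhds_zero_nat _
  have h2 : Tendsto (fun n : ℕ => ((2 : ℝ) ^ (-ε)) ^ n) atTop (𝓝 0) :=
    tendsto_pow_atTop_nhds_zero_of_lt_one (by positivity)
      (Real.rpow_lt_one_of_one_lt_of_neg one_lt_two (by linarith))
  have h3 := h1.add h2
  rw [add_zero] at h3
  refine h3.congr fun n => ?_
  rw [← Real.rpow_mul_natCast two_pos.le]
  ring_nf

theorem CSICode.avgError_bsc {M n : ℕ} (q p : S → ℝ) (c : CSICode S (Fin 2) (Fin 2) M n) :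
    c.avgError q (fun s => bsc (p s)) = (1 / (M : ℝ)) * ∑ m, ∑ s : Fin n → S, (∏ i, q (s i)) *
      ∑ y, if c.dec y s = m then 0 else noiseProb p s (y - c.enc m s) := by
  simp only [CSICode.avgError, prod_bsc_eq_noiseProb]

theorem CSICode.one_sub_avgError_bsc {M n : ℕ} (hM : 0 < M) {q : S → ℝ}
    (hq : q ∈ stdSimplex ℝ S) (p : S → ℝ) (c : CSICode S (Fin 2) (Fin 2) M n) :
    1 - c.avgError q (fun s => bsc (p s)) =
      (1 / (M : ℝ)) * ∑ m, ∑ s : Fin n → S, (∏ i, q (s i)) *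
        ∑ y, if c.dec y s = m then noiseProb p s (y - c.enc m s) else 0 := by
  rw [c.avgError_bsc, sub_eq_iff_eq_add, ← mul_add, ← Finset.sum_add_distrib]
  have h : ∀ m, (∑ s : Fin n → S, (∏ i, q (s i)) *
        ∑ y, if c.dec y s = m then noiseProb p s (y - c.enc m s) else 0) +
      (∑ s : Fin n → S, (∏ i, q (s i)) *
        ∑ y, if c.dec y s = m then 0 else noiseProb p s (y - c.enc m s)) = 1 := by
    intro m
    rw [← Finset.sum_add_distrib, ← sum_pi_prod_eq_one hq.2 n]
    refine Finset.sum_congr rfl fun s _ => ?_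
    rw [← mul_add, ← Finset.sum_add_distrib]
    have h1 : ∀ y, (if c.dec y s = m then noiseProb p s (y - c.enc m s) else 0) +
        (if c.dec y s = m then 0 else noiseProb p s (y - c.enc m s)) =
          noiseProb p s (y - c.enc m s) := fun y => by split_ifs <;> simp
    simp only [h1]
    have h2 : ∑ y, noiseProb p s (y - c.enc m s) = 1 :=
      (Equiv.sum_comp (Equiv.subRight (c.enc m s)) (noiseProb p s)).trans (sum_noiseProb p s)
    rw [h2, mul_one]
  have hM' : (M : ℝ) ≠ 0 := by exact_mod_cast hM.ne'
  simp only [h]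
  simp [hM']

theorem CSICode.avgError_bsc_nonneg {M n : ℕ} {q : S → ℝ} (hq : q ∈ stdSimplex ℝ S) {p : S → ℝ}
    (hp : ∀ s, p s ∈ Set.Icc (0 : ℝ) 1) (c : CSICode S (Fin 2) (Fin 2) M n) :
    0 ≤ c.avgError q (fun s => bsc (p s)) := by
  rw [c.avgError_bsc]
  refine mul_nonneg (by positivity) (Finset.sum_nonneg fun m _ => Finset.sum_nonneg fun s _ =>
    mul_nonneg (Finset.prod_nonneg fun i _ => hq.1 _) (Finset.sum_nonneg fun y _ => ?_))
  split_ifs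
  · exact le_rfl
  · exact noiseProb_nonneg hp _ _

theorem card_binary_words (n : ℕ) : (Fintype.card (Fin n → Fin 2) : ℝ) = (2 : ℝ) ^ (n : ℝ) := by
  simp

theorem mem_achievableRatesED_of_lt (csi : EncoderCSI) {q : S → ℝ} (hq : q ∈ stdSimplex ℝ S)
    {p : S → ℝ} (hp : ∀ s, p s ∈ Set.Icc (0 : ℝ) 1) {R : ℝ} (hR0 : 0 ≤ R)
    (hR : R < 1 - meanH2 q p) : R ∈ achievableRatesED csi q (fun s => bsc (p s)) := by
  classical
  obtain ⟨K, hK⟩ := exists_noise_concentration hq hp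
  -- With half the gap to capacity as `ε`, the collision exponent R + (E[H2(P)] + ε) - 1 equals -ε.
  obtain ⟨ε, hε⟩ : ∃ ε, ε = (1 - meanH2 q p - R) / 2 := ⟨_, rfl⟩
  have hε0 : 0 < ε := by linarith
  have key : ∀ n : ℕ, ∃ c : CSICode S (Fin 2) (Fin 2) (numMessages R n) n, c.Admissible csi ∧
      (0 < n → c.avgError q (fun s => bsc (p s)) ≤ K / ε ^ 2 / n + (2 : ℝ) ^ (-(n * ε))) := by
    intro n
    obtain ⟨c, dec, hc⟩ := exists_code_error_le (A := Fin n → S) (G := Fin n → Fin 2)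
      (Q := fun s => ∏ i, q (s i)) (fun s => Finset.prod_nonneg fun i _ => hq.1 _)
      (sum_pi_prod_eq_one hq.2 n) (N := noiseProb p) (noiseProb_nonneg hp) (sum_noiseProb p)
      (fun s => {z | (2 : ℝ) ^ (-(n * (meanH2 q p + ε))) ≤ noiseProb p s z})
      -- The words in the set have total probability at most 1 and each has at least 1 / `B`, so
      -- there are at most `B` of them.
      (B := (2 : ℝ) ^ (n * (meanH2 q p + ε))) (fun s => by
        calc _ ≤ ∑ z, noiseProb p s z * (2 : ℝ) ^ (n * (meanH2 q p + ε)) := by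
              refine Finset.sum_le_sum fun z _ => ?_
              have h0 := noiseProb_nonneg hp s z
              split_ifs with h
              · rw [Set.mem_ofPred_eq, Real.rpow_neg two_pos.le] at h
                rwa [← inv_le_iff_one_le_mul₀ (by positivity)]
              · positivity
          _ = _ := by rw [← Finset.sum_mul, sum_noiseProb, one_mul]) (numMessages_pos R n)
    refine ⟨⟨fun m _ => c m, dec⟩, ?_, fun hn => ?_⟩
    · cases csi
      · exact fun _ _ _ _ _ => rfl
      · exact trivial
    · rw [CSICode.avgError_bsc]
      refine hc.trans (add_le_add ((hK ε hε0 n hn).1) ?_)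
      rw [card_binary_words, ← Real.rpow_sub two_pos]
      have hM : (numMessages R n : ℝ) - 1 ≤ (2 : ℝ) ^ (n * R) := by
        have := Nat.ceil_lt_add_one (Real.rpow_pos_of_pos two_pos ((n : ℝ) * R)).le
        unfold numMessages
        linarith
      refine (mul_le_mul_of_nonneg_right hM (by positivity)).trans (le_of_eq ?_)
      rw [← Real.rpow_add two_pos]
      congr 1
      rw [hε]
      ring
  choose c hadm hc using key
  refine ⟨hR0, c, hadm, ?_⟩
  refine tendsto_of_tendsto_of_tendsto_of_le_of_le' tendsto_const_nhds (tendsto_error_bound K hε0)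
    (Eventually.of_forall fun n => (c n).avgError_bsc_nonneg hq hp) ?_
  filter_upwards [eventually_gt_atTop 0] with n hn using hc n hn

/-- Rate 0 means a single message, which is never decoded wrongly. This covers the case of capacity
0, where no rate lies strictly below capacity. -/
theorem zero_mem_achievableRatesED (csi : EncoderCSI) (q p : S → ℝ) :
    0 ∈ achievableRatesED csi q (fun s => bsc (p s)) := by
  refine ⟨le_rfl, fun n => ⟨fun _ _ _ => 0, fun _ _ => ⟨0, numMessages_pos 0 n⟩⟩, fun n => ?_, ?_⟩
  · cases csi
    · exact fun _ _ _ _ _ => rfl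
    · exact trivial
  · refine tendsto_const_nhds.congr fun n => ?_
    have h : ∀ m : Fin (numMessages 0 n), (⟨0, numMessages_pos 0 n⟩ : Fin _) = m := by
      intro m
      have h1 : numMessages 0 n = 1 := by simp [numMessages]
      apply Fin.ext
      have := m.2
      simp only
      omega
    simp only [CSICode.avgError, if_pos (h _), Finset.sum_const_zero, mul_zero]

/-- Strong converse: above capacity the probability of correct decoding tends to 0, whereas
achievability would force it to tend to 1. -/
theorem le_of_mem_achievableRatesED {csi : EncoderCSI} {q : S → ℝ} (hq : q ∈ stdSimplex ℝ S)
    {p : S → ℝ} (hp : ∀ s, p s ∈ Set.Icc (0 : ℝ) 1) {R : ℝ}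
    (hR : R ∈ achievableRatesED csi q (fun s => bsc (p s))) : R ≤ 1 - meanH2 q p := by
  by_contra! hlt
  obtain ⟨-, c, -, hc⟩ := hR
  obtain ⟨K, hK⟩ := exists_noise_concentration hq hp
  obtain ⟨ε, hε⟩ : ∃ ε, ε = (R - (1 - meanH2 q p)) / 2 := ⟨_, rfl⟩
  have hε0 : 0 < ε := by linarith
  have hs : ∀ n : ℕ, 0 < n →
      1 - (c n).avgError q (fun s => bsc (p s)) ≤ K / ε ^ 2 / n + (2 : ℝ) ^ (-(n * ε)) := by
    intro n hn
    rw [CSICode.one_sub_avgError_bsc (numMessages_pos R n) hq]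
    refine (success_le (A := Fin n → S) (G := Fin n → Fin 2)
      (Q := fun s => ∏ i, q (s i)) (fun s => Finset.prod_nonneg fun i _ => hq.1 _)
      (sum_pi_prod_eq_one hq.2 n) (N := noiseProb p) (b := (2 : ℝ) ^ (-(n * (meanH2 q p - ε))))
      (by positivity) (numMessages_pos R n) (noiseProb_nonneg hp) (c n).enc (c n).dec).trans
      (add_le_add ((hK ε hε0 n hn).2) ?_)
    have hM : (2 : ℝ) ^ (n * R) ≤ numMessages R n := Nat.le_ceil _
    rw [card_binary_words, ← Real.rpow_add two_pos]
    refine (div_le_div_of_nonneg_left (by positivity) (by positivity) hM).trans (le_of_eq ?_)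
    rw [← Real.rpow_sub two_pos]
    congr 1
    rw [hε]
    ring
  have h1 : Tendsto (fun n => 1 - (c n).avgError q (fun s => bsc (p s))) atTop (𝓝 (1 - 0)) :=
    tendsto_const_nhds.sub hc
  have h2 := le_of_tendsto_of_tendsto h1 (tendsto_error_bound K hε0)
    (by filter_upwards [eventually_gt_atTop 0] with n hn using hs n hn)
  norm_num at h2

theorem isLUB_achievableRatesED (csi : EncoderCSI) {q : S → ℝ} (hq : q ∈ stdSimplex ℝ S)
    {p : S → ℝ} (hp : ∀ s, p s ∈ Set.Icc (0 : ℝ) 1) :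
    IsLUB (achievableRatesED csi q (fun s => bsc (p s))) (1 - meanH2 q p) := by
  refine ⟨fun R hR => le_of_mem_achievableRatesED hq hp hR, fun b hb => ?_⟩
  -- This makes the midpoint used below a nonnegative rate.
  have hb0 : 0 ≤ b := hb (zero_mem_achievableRatesED csi q p)
  by_contra! hlt
  have := hb (mem_achievableRatesED_of_lt csi hq hp (R := (b + (1 - meanH2 q p)) / 2)
    (by linarith) (by linarith))
  linarith

/-- With one state there is only one state sequence, of probability 1, so CSI carries no
information. -/
theorem achievableRates_eq_achievableRatesED (W : Fin 2 → Fin 2 → ℝ) :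
    achievableRates W = achievableRatesED .noncausal (fun _ : Unit => 1) (fun _ => W) := by
  ext R
  refine and_congr_right fun _ => ⟨?_, ?_⟩
  · rintro ⟨c, hc⟩
    refine ⟨fun n => ⟨fun m _ => (c n).enc m, fun y _ => (c n).dec y⟩, fun _ => trivial, ?_⟩
    refine hc.congr fun n => ?_
    simp [CSICode.avgError, Code.avgError]
  · rintro ⟨c, -, hc⟩
    refine ⟨fun n => ⟨fun m => (c n).enc m default, fun y => (c n).dec y default⟩, ?_⟩
    refine hc.congr fun n => ?_
    simp [CSICode.avgError, Code.avgError]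

theorem isLUB_achievableRates_bsc {p : ℝ} (hp : p ∈ Set.Icc (0 : ℝ) 1) :
    IsLUB (achievableRates (bsc p)) (1 - H2 p) := by
  rw [achievableRates_eq_achievableRatesED]
  simpa [meanH2] using isLUB_achievableRatesED .noncausal (q := fun _ : Unit => 1)
    ⟨fun _ => zero_le_one, by simp⟩ (p := fun _ => p) fun _ => hp

theorem capacityED_bsc (csi : EncoderCSI) {q : S → ℝ} (hq : q ∈ stdSimplex ℝ S)
    {p : S → ℝ} (hp : ∀ s, p s ∈ Set.Icc (0 : ℝ) 1) :
    capacityED csi q (fun s => bsc (p s)) = 1 - meanH2 q p :=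
  (isLUB_achievableRatesED csi hq hp).csSup_eq ⟨0, zero_mem_achievableRatesED csi q p⟩

theorem CBSC_eq {p : ℝ} (hp : p ∈ Set.Icc (0 : ℝ) 1) : CBSC p = 1 - H2 p := by
  refine (isLUB_achievableRates_bsc hp).csSup_eq ⟨0, ?_⟩
  rw [achievableRates_eq_achievableRatesED]
  exact zero_mem_achievableRatesED .noncausal (fun _ : Unit => 1) fun _ => p

end Coding

/-! ### Maximization of the conditional mutual information. -/

section MutualInformation

variable {S : Type*} [Fintype S]

theorem sum_output_bsc {κ : Fin 2 → ℝ} (hκ : κ ∈ stdSimplex ℝ (Fin 2)) (p : ℝ) :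
    ∑ y, ∑ x, κ x * bsc p x y = 1 := by
  rw [Finset.sum_comm]
  simp only [← Finset.mul_sum, sum_bsc, mul_one, hκ.2]

/-- In each state, I(X;Y) = H(Y) - H(Y|X), and H(Y|X) = H2(p) for every input law because each row
of the channel has entropy H2(p). -/
theorem condMutualInfo_jointPmf_bsc (q : S → ℝ) {p : S → ℝ} (hp : ∀ s, p s ∈ Set.Icc (0 : ℝ) 1)
    {κ : S → Fin 2 → ℝ} (hκ : ∀ s, κ s ∈ stdSimplex ℝ (Fin 2)) :
    condMutualInfo (jointPmf q κ fun s => bsc (p s)) =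
      ∑ s, q s * (H2 (∑ x, κ s x * bsc (p s) x 0) - H2 (p s)) := by
  refine Finset.sum_congr rfl fun s _ => ?_
  rcases eq_or_ne (q s) 0 with hqs | hqs
  · simp [jointPmf, hqs]
  set v : Fin 2 → ℝ := fun y => ∑ x, κ s x * bsc (p s) x y with hv
  have hv1 : v 1 = 1 - v 0 := by
    have := sum_output_bsc (hκ s) (p s)
    rw [Fin.sum_univ_two] at this
    simp only [hv]
    linarith
  have hterm : ∀ x y, jointPmf q κ (fun s => bsc (p s)) s x y *
      Real.logb 2 ((jointPmf q κ (fun s => bsc (p s)) s x y *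
        ∑ x', ∑ y', jointPmf q κ (fun s => bsc (p s)) s x' y') /
        ((∑ y', jointPmf q κ (fun s => bsc (p s)) s x y') *
          ∑ x', jointPmf q κ (fun s => bsc (p s)) s x' y)) =
      q s * (κ s x * (bsc (p s) x y * Real.logb 2 (bsc (p s) x y)) -
        κ s x * bsc (p s) x y * Real.logb 2 (v y)) := by
    intro x y
    simp only [jointPmf, mul_assoc]
    simp only [← Finset.mul_sum, sum_bsc, mul_one, (hκ s).2]
    rw [mul_assoc (q s) (κ s x)]
    change q s * (κ s x * (bsc (p s) x y * Real.logb 2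
      (q s * (κ s x * (bsc (p s) x y * q s)) / (q s * (κ s x * (q s * v y)))))) = _
    -- Terms of zero weight vanish whatever their logarithm; in the others the factors `q s` and `κ
    -- s x` cancel.
    rcases eq_or_ne (κ s x) 0 with hk | hk
    · simp [hk]
    rcases eq_or_ne (bsc (p s) x y) 0 with hW | hW
    · simp [hW]
    have hvy : v y ≠ 0 := by
      have hnn : ∀ x ∈ Finset.univ, 0 ≤ κ s x * bsc (p s) x y := fun x _ =>
        mul_nonneg ((hκ s).1 x) (bsc_nonneg (hp s) _ _)
      refine (lt_of_lt_of_le ?_ (Finset.single_le_sum hnn (Finset.mem_univ x))).ne'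
      exact lt_of_le_of_ne (hnn x (Finset.mem_univ x)) (mul_ne_zero hk hW).symm
    have : q s * (κ s x * (bsc (p s) x y * q s)) / (q s * (κ s x * (q s * v y))) =
        bsc (p s) x y / v y := by field_simp
    rw [this, Real.logb_div hW hvy]
    ring
  simp only [hterm, ← Finset.mul_sum, Finset.sum_sub_distrib, sum_bsc_mul_logb, ← Finset.sum_mul,
    (hκ s).2]
  rw [Finset.sum_comm]
  simp only [← Finset.sum_mul]
  rw [Fin.sum_univ_two]
  change q s * (1 * -H2 (p s) - (v 0 * Real.logb 2 (v 0) + v 1 * Real.logb 2 (v 1))) =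
    q s * (H2 (v 0) - H2 (p s))
  rw [hv1, H2.eq_1 (v 0)]
  ring

theorem condMutualInfo_bsc_le {q : S → ℝ} (hq : q ∈ stdSimplex ℝ S) {p : S → ℝ}
    (hp : ∀ s, p s ∈ Set.Icc (0 : ℝ) 1) {κ : S → Fin 2 → ℝ}
    (hκ : ∀ s, κ s ∈ stdSimplex ℝ (Fin 2)) :
    condMutualInfo (jointPmf q κ fun s => bsc (p s)) ≤ 1 - meanH2 q p := by
  rw [condMutualInfo_jointPmf_bsc q hp hκ, one_sub_meanH2 hq]
  refine Finset.sum_le_sum fun s _ => ?_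
  exact mul_le_mul_of_nonneg_left (sub_le_sub_right (H2_le_one _) _) (hq.1 s)

theorem uniform_mem_stdSimplex : (fun _ => 1 / 2 : Fin 2 → ℝ) ∈ stdSimplex ℝ (Fin 2) :=
  ⟨fun _ => by norm_num, by norm_num⟩

/-- A uniform input makes the output uniform in every state, where H2 attains its maximum 1. -/
theorem condMutualInfo_bsc_uniform {q : S → ℝ} (hq : q ∈ stdSimplex ℝ S) {p : S → ℝ}
    (hp : ∀ s, p s ∈ Set.Icc (0 : ℝ) 1) :
    condMutualInfo (jointPmf q (fun _ _ => 1 / 2) fun s => bsc (p s)) = 1 - meanH2 q p := by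
  rw [condMutualInfo_jointPmf_bsc q hp fun _ => uniform_mem_stdSimplex,
    one_sub_meanH2 hq]
  refine Finset.sum_congr rfl fun s _ => ?_
  have h1 : ∑ x, 1 / 2 * bsc (p s) x 0 = (2 : ℝ)⁻¹ := by
    simp [bsc, Fin.sum_univ_two]
    ring
  have h2 : H2 (2 : ℝ)⁻¹ = 1 := by
    rw [H2_eq_binEntropy_div, Real.binEntropy_two_inv, div_self (Real.log_pos one_lt_two).ne']
  rw [h1, h2]

end MutualInformation

end VBSC

/-! ### The capacity theorem. -/

theorem mainTheorem2 (S : Finset unitInterval) (q : S → ℝ) (hq : q ∈ stdSimplex ℝ S)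
    (csi : VBSC.EncoderCSI) :
    -- the capacities below are genuine suprema of sets of achievable rates
    IsLUB (VBSC.achievableRatesED csi q (VBSC.vbsc S)) (VBSC.capacityED csi q (VBSC.vbsc S)) ∧
    (∀ p : S, IsLUB (VBSC.achievableRates (VBSC.vbsc S p)) (VBSC.CBSC (p : unitInterval))) ∧
    -- the capacity is the expected capacity of the binary symmetric channel
    VBSC.capacityED csi q (VBSC.vbsc S) = ∑ p : S, q p * VBSC.CBSC (p : unitInterval) ∧
    VBSC.capacityED csi q (VBSC.vbsc S) = 1 - ∑ p : S, q p * VBSC.H2 (p : unitInterval) ∧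
    -- it is the maximum of `I(X;Y|P)` over all conditional input distributions
    IsGreatest {I : ℝ | ∃ κ : S → Fin 2 → ℝ, (∀ p, κ p ∈ stdSimplex ℝ (Fin 2)) ∧
        I = VBSC.condMutualInfo (VBSC.jointPmf q κ (VBSC.vbsc S))}
      (VBSC.capacityED csi q (VBSC.vbsc S)) ∧
    -- and the uniform input attains it
    VBSC.condMutualInfo (VBSC.jointPmf q (fun _ _ => 1 / 2) (VBSC.vbsc S)) =
      VBSC.capacityED csi q (VBSC.vbsc S) := by
  have hp : ∀ p : S, ((p : unitInterval) : ℝ) ∈ Set.Icc (0 : ℝ) 1 := fun p => p.1.2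
  have hcap : VBSC.capacityED csi q (VBSC.vbsc S) =
      1 - ∑ p : S, q p * VBSC.H2 (p : unitInterval) := VBSC.capacityED_bsc csi hq hp
  have huni : VBSC.condMutualInfo (VBSC.jointPmf q (fun _ _ => 1 / 2) (VBSC.vbsc S)) =
      VBSC.capacityED csi q (VBSC.vbsc S) :=
    (VBSC.condMutualInfo_bsc_uniform hq hp).trans hcap.symm
  refine ⟨?_, fun p => ?_, ?_, hcap, ⟨⟨_, fun _ => VBSC.uniform_mem_stdSimplex, huni.symm⟩, ?_⟩,
    huni⟩
  · rw [hcap]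
    exact VBSC.isLUB_achievableRatesED csi hq hp
  · rw [VBSC.CBSC_eq (hp p)]
    exact VBSC.isLUB_achievableRates_bsc (hp p)
  · simp only [hcap, VBSC.CBSC_eq (hp _), mul_sub, mul_one, Finset.sum_sub_distrib, hq.2]
  · rintro I ⟨κ, hκ, rfl⟩
    rw [hcap]
    exact VBSC.condMutualInfo_bsc_le hq hp hκ
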